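/- All Hilbert spaces are finite-dimensional and complex; $\log$ is the logarithm to an arbitrary fixed base $\beta>1$, with $\log 0=-\infty$, and $\exp(x)=\beta^{x}$. For a system $A$ let $\mathcal S_\bullet(A)$ be the set of positive semi-definite operators on $A$ with trace at most $1$, and $\mathcal S_\circ(A)$ the set of those with trace equal to $1$. For positive semi-definite $\rho,\tau$ let $F(\rho,\tau)=\big(\operatorname{tr}|\sqrt\rho\sqrt\tau|\big)^2$ be the fidelity. For $\rho,\tau\in\mathcal S_\bullet(A)$ let $$F_*(\rho,\tau)=\Big(\operatorname{tr}|\sqrt\rho\sqrt\tau|+\sqrt{(1-\operatorname{tr}\rho)(1-\operatorname{tr}\tau)}\Big)^2,\qquad P(\rho,\tau)=\sqrt{1-F_*(\rho,\tau)}$$ be the generalized fidelity and the purified distance. For $\rho\in\mathcal S_\bullet(AB)$ and $0\le\varepsilon<\sqrt{\operatorname{tr}\rho}$ let $\mathcal B^\varepsilon(\rho)=\{\tau\in\mathcal S_\bullet(AB): P(\tau,\rho)\le\varepsilon\}$. The min- and max-entropy of $A$ conditioned on $B$ of $\rho\in\mathcal S_\bullet(AB)$ are $$H_{\min}(A|B)_\rho=\sup_{\sigma_B\in\mathcal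 S_\bullet(B)}\sup\{\lambda\in\mathbb R:\rho\le\exp(-\lambda)\,1_A\otimes\sigma_B\},\qquad H_{\max}(A|B)_\rho=\sup_{\sigma_B\in\mathcal S_\bullet(B)}\log F(\rho,1_A\otimes\sigma_B),$$ with values in $[-\infty,\infty]$, and their smooth versions are $$H_{\min}^{\varepsilon}(A|B)_\rho=\sup_{\tilde\rho\in\mathcal B^\varepsilon(\rho)}H_{\min}(A|B)_{\tilde\rho},\qquad H_{\max}^{\varepsilon}(A|B)_\rho=\inf_{\tilde\rho\in\mathcal B^\varepsilon(\rho)}H_{\max}(A|B)_{\tilde\rho}.$$ Proposition. Let $\rho\in\mathcal S_\circ(AB)$ and let $\varphi,\vartheta\ge 0$ satisfy $\varphi+\vartheta<\frac{\pi}{2}$. Then $$H_{\min}^{\sin\varphi}(A|B)_\rho\le H_{\max}^{\sin\vartheta}(A|B)_\rho+2\log\frac{1}{\cos(\varphi+\vartheta)}.$$ -/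

import Mathlib

open scoped Kronecker MatrixOrder ComplexOrder

namespace SmoothEntropy

/-! A finite-dimensional quantum system with Hilbert space `ℂ^n` is given by a finite index type `n`;
operators on it are matrices `Matrix n n ℂ`, ordered by the Loewner order. The joint system `AB` has
index type `a × b`. All logarithms and exponentials are taken to a base `β > 1`. Entropies take
values in `EReal`, so that all suprema and infima below are honest ones. -/

/-- Sub-normalized density operators: positive semi-definite with trace at most one. -/
def subnormalizedStates (n : Type*) [Fintype n] : Set (Matrix n n ℂ) :=
  {ρ | ρ.PosSemidef ∧ ρ.trace.re ≤ 1}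

/-- Normalized density operators: positive semi-definite with trace one. -/
def normalizedStates (n : Type*) [Fintype n] : Set (Matrix n n ℂ) :=
  {ρ | ρ.PosSemidef ∧ ρ.trace = 1}

/-- The root fidelity `tr |√ρ √τ|` of positive semi-definite operators. -/
noncomputable def rootFidelity {n : Type*} [Fintype n] [DecidableEq n]
    (ρ τ : Matrix n n ℂ) : ℝ :=
  (CFC.abs (CFC.sqrt ρ * CFC.sqrt τ)).trace.re

/-- Uhlmann's fidelity `F(ρ, τ) = (tr |√ρ √τ|)²`. -/
noncomputable def fidelity {n : Type*} [Fintype n] [DecidableEq n]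
    (ρ τ : Matrix n n ℂ) : ℝ :=
  rootFidelity ρ τ ^ 2

/-- The generalized fidelity `(tr |√ρ √τ| + √((1 - tr ρ) (1 - tr τ)))²` of sub-normalized states. -/
noncomputable def generalizedFidelity {n : Type*} [Fintype n] [DecidableEq n]
    (ρ τ : Matrix n n ℂ) : ℝ :=
  (rootFidelity ρ τ + Real.sqrt ((1 - ρ.trace.re) * (1 - τ.trace.re))) ^ 2

/-- The purified distance of sub-normalized states. -/
noncomputable def purifiedDistance {n : Type*} [Fintype n] [DecidableEq n]
    (ρ τ : Matrix n n ℂ) : ℝ :=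
  Real.sqrt (1 - generalizedFidelity ρ τ)

/-- The ball of sub-normalized states of radius `ε` around `ρ` in purified distance. -/
def ball {n : Type*} [Fintype n] [DecidableEq n] (ε : ℝ) (ρ : Matrix n n ℂ) :
    Set (Matrix n n ℂ) :=
  {τ | τ ∈ subnormalizedStates n ∧ purifiedDistance τ ρ ≤ ε}

/-- The logarithm of a non-negative real number to the base `β`, with `log 0 = -∞`. -/
noncomputable def elogb (β x : ℝ) : EReal :=
  if 0 < x then (Real.logb β x : EReal) else ⊥

/-- The min-entropy `H_min(A|B)_ρ`: the supremum of the real numbers `t` such that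
`ρ ≤ β^(-t) (1_A ⊗ σ)` for some sub-normalized state `σ` on `B`. -/
noncomputable def minEntropy {a b : Type*} [Fintype a] [DecidableEq a] [Fintype b] [DecidableEq b]
    (β : ℝ) (ρ : Matrix (a × b) (a × b) ℂ) : EReal :=
  ⨆ σ ∈ subnormalizedStates b,
    ⨆ t ∈ {t : ℝ | ρ ≤ (β ^ (-t) : ℝ) • ((1 : Matrix a a ℂ) ⊗ₖ σ)}, (t : EReal)

/-- The max-entropy `H_max(A|B)_ρ`: the supremum of `log F(ρ, 1_A ⊗ σ)` over all sub-normalized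
states `σ` on `B`. -/
noncomputable def maxEntropy {a b : Type*} [Fintype a] [DecidableEq a] [Fintype b] [DecidableEq b]
    (β : ℝ) (ρ : Matrix (a × b) (a × b) ℂ) : EReal :=
  ⨆ σ ∈ subnormalizedStates b, elogb β (fidelity ρ ((1 : Matrix a a ℂ) ⊗ₖ σ))

/-- The `ε`-smooth min-entropy: the largest min-entropy of a state in the `ε`-ball around `ρ`. -/
noncomputable def smoothMinEntropy {a b : Type*} [Fintype a] [DecidableEq a]
    [Fintype b] [DecidableEq b] (β ε : ℝ) (ρ : Matrix (a × b) (a × b) ℂ) : EReal :=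
  ⨆ τ ∈ ball ε ρ, minEntropy β τ

/-- The `ε`-smooth max-entropy: the smallest max-entropy of a state in the `ε`-ball around `ρ`. -/
noncomputable def smoothMaxEntropy {a b : Type*} [Fintype a] [DecidableEq a]
    [Fintype b] [DecidableEq b] (β ε : ℝ) (ρ : Matrix (a × b) (a × b) ℂ) : EReal :=
  ⨅ τ ∈ ball ε ρ, maxEntropy β τ

end SmoothEntropy

/-! Take `τ`, `τ'` in the two balls and `τ ≤ β^(-t) (1 ⊗ σ)`. Since `ρ` has trace one, the balls
give root fidelities with `ρ` of at least `cos φ` and `cos ϑ`. The triangle inequality for angles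
(`cos_add_le_rootFidelity`) yields `cos (φ + ϑ) ≤ rootFidelity τ τ'`, and monotonicity
(`rootFidelity_mono_left`) bounds this by `β^(-t/2) rootFidelity (1 ⊗ σ) τ'`. Squaring and taking
logarithms bounds `t`; the same `σ` is a candidate in the max-entropy of `τ'`, so no duality is
needed. -/

namespace SmoothEntropy
open Matrix

/-! ### Polar decomposition and trace inequalities for contractions -/

section Operators

variable {n : Type*} [Fintype n] [DecidableEq n]

open scoped Matrix.Norms.L2Operator in
theorem sqrt_le_sqrt {A B : Matrix n n ℂ} (h : A ≤ B) : CFC.sqrt A ≤ CFC.sqrt B :=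
  CFC.sqrt_le_sqrt A B h

omit [DecidableEq n] in
theorem conjTranspose_mul_mul_le {A B : Matrix n n ℂ} (h : A ≤ B) (C : Matrix n n ℂ) :
    Cᴴ * A * C ≤ Cᴴ * B * C :=
  star_left_conjugate_le_conjugate h C

omit [DecidableEq n] in
theorem trace_re_mono {A B : Matrix n n ℂ} (h : A ≤ B) : A.trace.re ≤ B.trace.re := by
  have := (Matrix.le_iff.mp h).trace_nonneg
  rw [Matrix.trace_sub, sub_nonneg] at this
  exact (Complex.le_def.mp this).1

theorem conjTranspose_sqrt (A : Matrix n n ℂ) : (CFC.sqrt A)ᴴ = CFC.sqrt A :=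
  (IsSelfAdjoint.of_nonneg (CFC.sqrt_nonneg A)).star_eq

/-- Polar decomposition with a partial isometry. -/
theorem exists_partialIsometry_polar (M : Matrix n n ℂ) :
    ∃ W : Matrix n n ℂ, W * Wᴴ * W = W ∧ Wᴴ * M = CFC.abs M ∧ W * CFC.abs M = M := by
  set H := CFC.abs M with hH
  have hsa : IsSelfAdjoint H := IsSelfAdjoint.of_nonneg (CFC.abs_nonneg M)
  have hcont (f : ℝ → ℝ) : ContinuousOn f (spectrum ℝ H) :=
    (Matrix.finite_real_spectrum (A := H)).continuousOn f
  -- As `0⁻¹ = 0`, this is the pseudo-inverse of `H`; the partial isometry will be `M * G`.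
  set G := cfc (fun x : ℝ => x⁻¹) H with hG
  have hGsa : Gᴴ = G := (cfc_predicate (fun x : ℝ => x⁻¹) H : IsSelfAdjoint G).star_eq
  have hHid : cfc (fun x : ℝ => x) H = H := cfc_id' ℝ H
  have hGH' : G * H = cfc (fun x : ℝ => x⁻¹ * x) H := by
    rw [cfc_mul (fun x : ℝ => x⁻¹) (fun x => x) H (hcont _) (hcont _), hHid]
  have hGH : G * H = H * G := by
    have := cfc_commute_cfc (fun x : ℝ => x⁻¹) (fun x => x) H
    rw [hHid] at this
    exact this
  have hHGH : H * G * H = H := by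
    have := cfc_mul (fun x : ℝ => x) (fun x => x⁻¹ * x) H (hcont _) (hcont _)
    rw [← hGH', hHid] at this
    rw [Matrix.mul_assoc, ← this]
    simpa [← mul_assoc] using hHid
  have hGHG : G * H * G = G := by
    have := cfc_mul (fun x : ℝ => x⁻¹ * x) (fun x => x⁻¹) H (hcont _) (hcont _)
    rw [← hGH', ← hG] at this
    rw [← this, hG]
    congr 1
    funext x
    by_cases hx : x = 0 <;> simp [hx]
  have hMM : Mᴴ * M = H * H := (CFC.abs_mul_abs M).symm
  have hM : M * (1 - G * H) = 0 := by
    rw [← Matrix.conjTranspose_mul_self_eq_zero, conjTranspose_mul, Matrix.mul_assoc,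
      ← Matrix.mul_assoc Mᴴ, hMM, mul_sub, mul_one, Matrix.mul_assoc H H, ← Matrix.mul_assoc H G,
      hHGH, sub_self, mul_zero]
  refine ⟨M * G, ?_, ?_, ?_⟩
  · calc M * G * (M * G)ᴴ * (M * G) = M * (G * (G * (Mᴴ * M) * G)) := by
          rw [conjTranspose_mul, hGsa]; simp only [Matrix.mul_assoc]
      _ = M * G := by rw [hMM, ← Matrix.mul_assoc G H H, hGH, hHGH, ← Matrix.mul_assoc G H G, hGHG]
  · rw [conjTranspose_mul, hGsa, Matrix.mul_assoc, hMM, ← Matrix.mul_assoc, hGH, hHGH]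
  · rw [mul_sub, mul_one, sub_eq_zero, ← Matrix.mul_assoc] at hM
    exact hM.symm

theorem mul_conjTranspose_le_one {W : Matrix n n ℂ} (h : W * Wᴴ * W = W) : W * Wᴴ ≤ 1 := by
  have key : (1 - W * Wᴴ)ᴴ * (1 - W * Wᴴ) = 1 - W * Wᴴ := by
    simp only [conjTranspose_sub, conjTranspose_one, conjTranspose_mul, conjTranspose_conjTranspose]
    rw [sub_mul, one_mul, mul_sub, mul_one, ← Matrix.mul_assoc, h, sub_self, sub_zero]
  rw [Matrix.le_iff, ← key]
  exact Matrix.posSemidef_conjTranspose_mul_self _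

theorem conjTranspose_mul_le_one {W : Matrix n n ℂ} (h : W * Wᴴ * W = W) : Wᴴ * W ≤ 1 := by
  have h' : Wᴴ * Wᴴᴴ * Wᴴ = Wᴴ := by
    have := congrArg conjTranspose h
    simpa [Matrix.mul_assoc] using this
  simpa using mul_conjTranspose_le_one h'

/-- Expand `tr (1 - K) H (1 - K)ᴴ ≥ 0` and use `tr K H Kᴴ ≤ tr H`. -/
theorem re_trace_contraction_mul_le {K H : Matrix n n ℂ} (hK : Kᴴ * K ≤ 1) (hH : 0 ≤ H) :
    (K * H).trace.re ≤ H.trace.re := by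
  have hHs : Hᴴ = H := (IsSelfAdjoint.of_nonneg hH).star_eq
  have h0 := trace_re_mono (star_right_conjugate_nonneg hH (1 - K))
  have h1 := trace_re_mono (conjTranspose_mul_mul_le hK (CFC.sqrt H))
  have hs : CFC.sqrt H * CFC.sqrt H = H := CFC.sqrt_mul_sqrt_self H hH
  have e1 : ((CFC.sqrt H)ᴴ * (Kᴴ * K) * CFC.sqrt H).trace = (K * H * Kᴴ).trace := by
    rw [conjTranspose_sqrt, Matrix.trace_mul_comm, ← Matrix.mul_assoc, hs, ← Matrix.mul_assoc,
      Matrix.trace_mul_comm, ← Matrix.mul_assoc]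
  have e2 : (H * Kᴴ).trace.re = (K * H).trace.re := by
    have : H * Kᴴ = (K * H)ᴴ := by rw [conjTranspose_mul, hHs]
    rw [this, trace_conjTranspose]; simp
  rw [e1, conjTranspose_sqrt, mul_one, hs] at h1
  simp only [star_eq_conjTranspose, conjTranspose_sub, conjTranspose_one, sub_mul, mul_sub,
    one_mul, mul_one, trace_sub, trace_zero, Complex.sub_re, Complex.zero_re, e2] at h0
  linarith

theorem re_trace_contraction_mul_le_abs {K : Matrix n n ℂ} (hK : Kᴴ * K ≤ 1)
    (M : Matrix n n ℂ) : (K * M).trace.re ≤ (CFC.abs M).trace.re := by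
  obtain ⟨W, hW, -, hM⟩ := exists_partialIsometry_polar M
  have h : (K * W)ᴴ * (K * W) ≤ 1 := by
    have := conjTranspose_mul_mul_le hK W
    rw [conjTranspose_mul, Matrix.mul_assoc, ← Matrix.mul_assoc Kᴴ, ← Matrix.mul_assoc]
    rw [mul_one] at this
    exact this.trans (conjTranspose_mul_le_one hW)
  have := re_trace_contraction_mul_le h (CFC.abs_nonneg M)
  rwa [Matrix.mul_assoc, hM] at this

theorem re_trace_abs_conjTranspose_le (M : Matrix n n ℂ) :
    (CFC.abs Mᴴ).trace.re ≤ (CFC.abs M).trace.re := by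
  obtain ⟨W, hW, hM, -⟩ := exists_partialIsometry_polar Mᴴ
  have h := re_trace_contraction_mul_le_abs (conjTranspose_mul_le_one hW) M
  rw [← hM, ← conjTranspose_mul, trace_conjTranspose, Matrix.trace_mul_comm]
  simpa using h

end Operators

/-! ### Root fidelity and its angle triangle inequality -/

section Fidelity

variable {n : Type*} [Fintype n] [DecidableEq n]

theorem rootFidelity_comm (ρ τ : Matrix n n ℂ) : rootFidelity ρ τ = rootFidelity τ ρ := by
  have key (ρ τ : Matrix n n ℂ) : rootFidelity ρ τ ≤ rootFidelity τ ρ := by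
    have := re_trace_abs_conjTranspose_le (CFC.sqrt τ * CFC.sqrt ρ)
    rwa [conjTranspose_mul, conjTranspose_sqrt, conjTranspose_sqrt] at this
  exact le_antisymm (key _ _) (key _ _)

theorem rootFidelity_nonneg (ρ τ : Matrix n n ℂ) : 0 ≤ rootFidelity ρ τ := by
  have := trace_re_mono (CFC.abs_nonneg (CFC.sqrt ρ * CFC.sqrt τ))
  rwa [trace_zero, Complex.zero_re] at this

/-- `|√ρ √τ|² = √τ ρ √τ` is linear in `ρ`, and the square root is operator monotone. -/
theorem rootFidelity_mono_left {ρ ρ' : Matrix n n ℂ} (h0 : 0 ≤ ρ) (h : ρ ≤ ρ')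
    (τ : Matrix n n ℂ) : rootFidelity ρ τ ≤ rootFidelity ρ' τ := by
  have key (ρ : Matrix n n ℂ) (h0 : 0 ≤ ρ) :
      star (CFC.sqrt ρ * CFC.sqrt τ) * (CFC.sqrt ρ * CFC.sqrt τ) =
      (CFC.sqrt τ)ᴴ * ρ * CFC.sqrt τ := by
    rw [star_eq_conjTranspose, conjTranspose_mul, conjTranspose_sqrt, conjTranspose_sqrt,
      Matrix.mul_assoc, ← Matrix.mul_assoc (CFC.sqrt ρ), CFC.sqrt_mul_sqrt_self ρ h0, Matrix.mul_assoc]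
  unfold rootFidelity CFC.abs
  rw [key ρ h0, key ρ' (h0.trans h)]
  exact trace_re_mono (sqrt_le_sqrt (conjTranspose_mul_mul_le h _))

theorem sqrt_smul {c : ℝ} (hc : 0 ≤ c) {A : Matrix n n ℂ} (hA : 0 ≤ A) :
    CFC.sqrt (c • A) = √c • CFC.sqrt A := by
  apply CFC.sqrt_unique
  · rw [smul_mul_smul_comm, Real.mul_self_sqrt hc, CFC.sqrt_mul_sqrt_self A hA]
  · exact smul_nonneg (Real.sqrt_nonneg c) (CFC.sqrt_nonneg A)

theorem rootFidelity_smul_left {c : ℝ} (hc : 0 ≤ c) {ρ : Matrix n n ℂ} (hρ : 0 ≤ ρ)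
    (τ : Matrix n n ℂ) : rootFidelity (c • ρ) τ = √c * rootFidelity ρ τ := by
  unfold rootFidelity
  rw [sqrt_smul hc hρ, smul_mul_assoc, CFC.abs_smul, Real.norm_of_nonneg (Real.sqrt_nonneg c),
    trace_smul, Complex.smul_re, smul_eq_mul]

/-- Split off the components of `x` and `y` along `r`. The remainders have norms at most the sines
of the angles to `r`, so Cauchy–Schwarz and the addition formula for cosine apply. -/
theorem cos_add_le_re_inner {E : Type*} [NormedAddCommGroup E] [InnerProductSpace ℂ E]
    {x y r : E} (hx : ‖x‖ ≤ 1) (hy : ‖y‖ ≤ 1) (hr : ‖r‖ = 1) {φ ϑ : ℝ} (hφ : 0 ≤ φ) (hϑ : 0 ≤ ϑ)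
    (hsum : φ + ϑ ≤ Real.pi) (hxr : Real.cos φ ≤ (inner ℂ x r).re)
    (hyr : Real.cos ϑ ≤ (inner ℂ y r).re) : Real.cos (φ + ϑ) ≤ (inner ℂ x y).re := by
  set c := (inner ℂ x r : ℂ).re with hc
  set d := (inner ℂ y r : ℂ).re with hd
  have hle {z : E} (hz : ‖z‖ ≤ 1) : (inner ℂ z r : ℂ).re ≤ 1 := by
    have := re_inner_le_norm (𝕜 := ℂ) z r
    rw [hr, mul_one] at this
    exact this.trans hz
  have hge {t s : ℝ} (ht : 0 ≤ t) (ht' : t ≤ Real.pi) (hs : Real.cos t ≤ s) :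
      -1 ≤ s ∧ Real.arccos s ≤ t := by
    refine ⟨(Real.neg_one_le_cos t).trans hs, ?_⟩
    rw [← Real.arccos_cos ht ht']
    exact Real.arccos_le_arccos hs
  have hre (z : E) : (inner ℂ r z : ℂ).re = (inner ℂ z r : ℂ).re := inner_re_symm (𝕜 := ℂ) r z
  have hrr : (inner ℂ r r : ℂ).re = 1 := by
    have := inner_self_eq_norm_sq (𝕜 := ℂ) r
    rw [hr, one_pow] at this
    exact this
  have hexp (z w : E) (s t : ℝ) : (inner ℂ (z - (s : ℂ) • r) (w - (t : ℂ) • r) : ℂ).re =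
      (inner ℂ z w : ℂ).re - t * (inner ℂ z r : ℂ).re - s * (inner ℂ w r : ℂ).re + s * t := by
    simp only [inner_sub_left, inner_sub_right, inner_smul_left, inner_smul_right,
      Complex.conj_ofReal, Complex.sub_re, Complex.re_ofReal_mul, hre w, hrr]
    ring
  have hnorm {z : E} (hz : ‖z‖ ≤ 1) : ‖z - (((inner ℂ z r : ℂ).re : ℝ) : ℂ) • r‖ ≤
      Real.sin (Real.arccos (inner ℂ z r : ℂ).re) := by
    rw [Real.sin_arccos]
    apply Real.le_sqrt_of_sq_le
    have h1 : (inner ℂ z z : ℂ).re = ‖z‖ ^ 2 := inner_self_eq_norm_sq (𝕜 := ℂ) z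
    have h2 := inner_self_eq_norm_sq (𝕜 := ℂ) (z - (((inner ℂ z r : ℂ).re : ℝ) : ℂ) • r)
    rw [← h2]
    refine (hexp z z _ _).trans_le ?_
    nlinarith [norm_nonneg z]
  obtain ⟨hc1, hcφ⟩ := hge hφ (by linarith) hxr
  obtain ⟨hd1, hdϑ⟩ := hge hϑ (by linarith) hyr
  -- The sign turns Cauchy–Schwarz into a lower bound.
  have hCS := re_inner_le_norm (𝕜 := ℂ) (-(x - (c : ℂ) • r)) (y - (d : ℂ) • r)
  rw [inner_neg_left, norm_neg] at hCS
  have hCS' : -(inner ℂ (x - (c : ℂ) • r) (y - (d : ℂ) • r) : ℂ).re ≤ _ := hCS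
  rw [hexp, ← hc, ← hd] at hCS'
  have hprod := mul_le_mul (hnorm hx) (hnorm hy) (norm_nonneg _)
    ((norm_nonneg _).trans (hnorm hx))
  rw [← hc, ← hd] at hprod
  have hmono : Real.cos (φ + ϑ) ≤ Real.cos (Real.arccos c + Real.arccos d) :=
    Real.cos_le_cos_of_nonneg_of_le_pi
      (add_nonneg (Real.arccos_nonneg c) (Real.arccos_nonneg d)) hsum (add_le_add hcφ hdϑ)
  rw [Real.cos_add (Real.arccos c), Real.cos_arccos hc1 (hle hx), Real.cos_arccos hd1 (hle hy)]
    at hmono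
  linarith

omit [DecidableEq n] in
theorem inner_toLp_matrix (X Y : Matrix n n ℂ) :
    inner ℂ (WithLp.toLp 2 (Function.uncurry X) : EuclideanSpace ℂ (n × n))
      (WithLp.toLp 2 (Function.uncurry Y)) = (Xᴴ * Y).trace := by
  simp only [PiLp.inner_apply, Function.uncurry, RCLike.inner_apply, trace, diag_apply, mul_apply,
    conjTranspose_apply, Fintype.sum_prod_type]
  rw [Finset.sum_comm]
  simp [mul_comm]

/-- In Hilbert–Schmidt space, polar factors `U`, `V` align `√τ U` and `√τ' V` with `√ρ`, so that
these overlaps equal the root fidelities. The overlap of the first two is at most `rootFidelity τ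
τ'`, as `V Uᴴ` is a contraction. -/
theorem cos_add_le_rootFidelity {ρ τ τ' : Matrix n n ℂ} (hρ : ρ ∈ normalizedStates n)
    (hτ : τ ∈ subnormalizedStates n) (hτ' : τ' ∈ subnormalizedStates n) {φ ϑ : ℝ} (hφ : 0 ≤ φ)
    (hϑ : 0 ≤ ϑ) (hsum : φ + ϑ ≤ Real.pi) (h : Real.cos φ ≤ rootFidelity τ ρ)
    (h' : Real.cos ϑ ≤ rootFidelity τ' ρ) : Real.cos (φ + ϑ) ≤ rootFidelity τ τ' := by
  obtain ⟨U, hU, hUM, -⟩ := exists_partialIsometry_polar (CFC.sqrt τ * CFC.sqrt ρ)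
  obtain ⟨V, hV, hVM, -⟩ := exists_partialIsometry_polar (CFC.sqrt τ' * CFC.sqrt ρ)
  let vec (X : Matrix n n ℂ) : EuclideanSpace ℂ (n × n) := WithLp.toLp 2 (Function.uncurry X)
  have hinner (X Y : Matrix n n ℂ) : inner ℂ (vec X) (vec Y) = (Xᴴ * Y).trace :=
    inner_toLp_matrix X Y
  have hnormsq (X : Matrix n n ℂ) : ‖vec X‖ ^ 2 = (Xᴴ * X).trace.re := by
    rw [← hinner]
    exact (inner_self_eq_norm_sq (𝕜 := ℂ) (vec X)).symm
  have hnorm {τ W : Matrix n n ℂ} (hτ : τ ∈ subnormalizedStates n) (hW : W * Wᴴ * W = W) :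
      ‖vec (CFC.sqrt τ * W)‖ ≤ 1 := by
    rw [← sq_le_one_iff₀ (norm_nonneg _), hnormsq, Matrix.trace_mul_comm]
    have h := trace_re_mono (conjTranspose_mul_mul_le (mul_conjTranspose_le_one hW) (CFC.sqrt τ))
    rw [conjTranspose_sqrt, mul_one,
      CFC.sqrt_mul_sqrt_self τ (Matrix.nonneg_iff_posSemidef.mpr hτ.1)] at h
    rw [conjTranspose_mul, conjTranspose_sqrt]
    simp only [Matrix.mul_assoc] at h ⊢
    exact h.trans hτ.2
  have hr : ‖vec (CFC.sqrt ρ)‖ = 1 := by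
    rw [← pow_eq_one_iff_of_nonneg (norm_nonneg _) two_ne_zero, hnormsq,
      conjTranspose_sqrt, CFC.sqrt_mul_sqrt_self ρ (Matrix.nonneg_iff_posSemidef.mpr hρ.1), hρ.2,
      Complex.one_re]
  have hoverlap {τ W : Matrix n n ℂ}
      (hW : Wᴴ * (CFC.sqrt τ * CFC.sqrt ρ) = CFC.abs (CFC.sqrt τ * CFC.sqrt ρ)) :
      (inner ℂ (vec (CFC.sqrt τ * W)) (vec (CFC.sqrt ρ))).re = rootFidelity τ ρ := by
    rw [hinner, conjTranspose_mul, conjTranspose_sqrt, Matrix.mul_assoc, hW, rootFidelity]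
  have key := cos_add_le_re_inner (hnorm hτ hU) (hnorm hτ' hV) hr hφ hϑ hsum
    (h.trans_eq (hoverlap hUM).symm) (h'.trans_eq (hoverlap hVM).symm)
  refine key.trans ?_
  have hK : (V * Uᴴ)ᴴ * (V * Uᴴ) ≤ 1 := by
    have := conjTranspose_mul_mul_le (conjTranspose_mul_le_one hV) Uᴴ
    rw [conjTranspose_conjTranspose, mul_one] at this
    rw [conjTranspose_mul, conjTranspose_conjTranspose]
    simp only [Matrix.mul_assoc] at this ⊢
    exact this.trans (mul_conjTranspose_le_one hU)
  have := re_trace_contraction_mul_le_abs hK (CFC.sqrt τ * CFC.sqrt τ')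
  rw [hinner, conjTranspose_mul, conjTranspose_sqrt, ← Matrix.mul_assoc, Matrix.trace_mul_comm]
  simpa only [Matrix.mul_assoc, rootFidelity] using this

theorem cos_le_rootFidelity_of_mem_ball {ρ τ : Matrix n n ℂ} (hρ : ρ ∈ normalizedStates n) {φ : ℝ}
    (hφ : 0 ≤ φ) (hφ' : φ ≤ Real.pi) (h : τ ∈ ball (Real.sin φ) ρ) :
    Real.cos φ ≤ rootFidelity τ ρ := by
  have h1 := (Real.sqrt_le_left (Real.sin_nonneg_of_nonneg_of_le_pi hφ hφ')).mp h.2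
  simp only [generalizedFidelity, hρ.2, Complex.one_re, sub_self, mul_zero, Real.sqrt_zero,
    add_zero] at h1
  refine abs_le_of_sq_le_sq' ?_ (rootFidelity_nonneg τ ρ) |>.2
  linarith [Real.sin_sq_add_cos_sq φ]

end Fidelity

end SmoothEntropy

theorem mainTheorem12 {a b : Type*} [Fintype a] [DecidableEq a] [Fintype b] [DecidableEq b]
    (β : ℝ) (hβ : 1 < β)
    (ρ : Matrix (a × b) (a × b) ℂ) (hρ : ρ ∈ SmoothEntropy.normalizedStates (a × b))
    (φ ϑ : ℝ) (hφ : 0 ≤ φ) (hϑ : 0 ≤ ϑ) (hsum : φ + ϑ < Real.pi / 2) :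
    SmoothEntropy.smoothMinEntropy β (Real.sin φ) ρ ≤
      SmoothEntropy.smoothMaxEntropy β (Real.sin ϑ) ρ +
        ((2 * Real.logb β (1 / Real.cos (φ + ϑ)) : ℝ) : EReal) := by
  have hπ := Real.pi_pos
  have hcos : 0 < Real.cos (φ + ϑ) := Real.cos_pos_of_mem_Ioo ⟨by linarith, hsum⟩
  have hβ0 : 0 < β := by linarith
  refine iSup₂_le fun τ hτ => iSup₂_le fun σ hσ => iSup₂_le fun t ht => ?_
  -- Moving the finite constant across exposes the infimum.
  rw [← EReal.sub_le_iff_le_add (.inl (EReal.coe_ne_bot _)) (.inl (EReal.coe_ne_top _))]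
  refine le_iInf₂ fun τ' hτ' => ?_
  refine le_trans ?_ (le_iSup₂ (f := fun σ (_ : σ ∈ SmoothEntropy.subnormalizedStates b) =>
    SmoothEntropy.elogb β (SmoothEntropy.fidelity τ' ((1 : Matrix a a ℂ) ⊗ₖ σ))) σ hσ)
  have hF := SmoothEntropy.cos_add_le_rootFidelity hρ hτ.1 hτ'.1 hφ hϑ (by linarith)
    (SmoothEntropy.cos_le_rootFidelity_of_mem_ball hρ hφ (by linarith) hτ)
    (SmoothEntropy.cos_le_rootFidelity_of_mem_ball hρ hϑ (by linarith) hτ')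
  have hσ0 : 0 ≤ (1 : Matrix a a ℂ) ⊗ₖ σ :=
    Matrix.nonneg_iff_posSemidef.mpr (Matrix.PosSemidef.one.kronecker hσ.1)
  have hc : 0 < β ^ (-t) := Real.rpow_pos_of_pos hβ0 _
  have hmono := SmoothEntropy.rootFidelity_mono_left (Matrix.nonneg_iff_posSemidef.mpr hτ.1.1) ht τ'
  rw [SmoothEntropy.rootFidelity_smul_left hc.le hσ0, SmoothEntropy.rootFidelity_comm _ τ'] at hmono
  have hsq := pow_le_pow_left₀ hcos.le
    ((hF.trans_eq (SmoothEntropy.rootFidelity_comm τ τ')).trans hmono) 2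
  rw [mul_pow, Real.sq_sqrt hc.le, SmoothEntropy.rootFidelity_comm _ τ', ← SmoothEntropy.fidelity,
    Real.rpow_neg hβ0.le, ← div_eq_inv_mul,
    le_div_iff₀ (Real.rpow_pos_of_pos hβ0 t)] at hsq
  have hpos : 0 < Real.cos (φ + ϑ) ^ 2 * β ^ t := by positivity
  have hlog := Real.logb_le_logb_of_le hβ hpos hsq
  -- The bound itself forces positive fidelity, excluding the value `⊥`.
  rw [SmoothEntropy.elogb, if_pos (hpos.trans_le hsq), ← EReal.coe_sub, EReal.coe_le_coe_iff]
  rw [Real.logb_mul (by positivity) (by positivity), Real.logb_pow, Real.logb_rpow hβ0 hβ.ne']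
    at hlog
  rw [one_div, Real.logb_inv]
  push_cast at hlog
  linarith
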